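/- Let $k\ge 2$. A linear $k$-chord diagram of length $kn$ is a partition of the $kn$ linearly arranged vertices $1,\dots,kn$ into $n$ blocks of size $k$, called $k$-chords. A short chord is a $k$-chord whose $k$ vertices are consecutive; two short chords are adjacent if a vertex of one is next to a vertex of the other, and a connected component of the diagram is a connected component of the resulting adjacency graph on its short chords, i.e. a maximal run of adjacent short chords. Let $X_n$ be the number of connected components of a linear $k$-chord diagram of length $kn$ chosen uniformly at random, and put $$\lambda_n = k!\,k^{1-k}\,n^{2-k}.$$ Then, as $n\to\infty$ with $k$ fixed, $X_n$ is asymptotically Poisson with mean $\lambda_n$, in the following sense. For every fixed integer $q\ge 0$, $$\Pr(X_n=q)\sim e^{-\lambda_n}\,\frac{\lambda_n^{q}}{q!},$$ and for every fixed integer $j\ge 0$ the factorial moments satisfy $$\mathbb{E}\bigl[X_n(X_n-1)\cdots(X_n-j+1)\bigr]\sim\lambda_n^{\,j}$$ (in particular $\mathbb{E}[X_n]\sim\lambda_n$), where $a_n\sim b_n$ means $a_n/b_n\to 1$. For $k=2$ this says that $X_n$ converges in distribution, and with all its moments, to the Poisson law of mean $1$. -/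

import Mathlib

open scoped NNReal Nat

/-- A linear `k`-chord diagram of length `k * n`: a partition of the linearly arranged vertices
`0, 1, …, k * n - 1` into blocks (the `k`-chords) with exactly `k` vertices each. -/
def LinearChordDiagram (k n : ℕ) : Type :=
  {P : Finpartition (Finset.univ : Finset (Fin (k * n))) // ∀ B ∈ P.parts, B.card = k}

namespace LinearChordDiagram

instance (k n : ℕ) : Fintype (LinearChordDiagram k n) :=
  inferInstanceAs (Fintype
    {P : Finpartition (Finset.univ : Finset (Fin (k * n))) // ∀ B ∈ P.parts, B.card = k})

variable {k n : ℕ}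

/-- The set of `k`-chords of a diagram. -/
def chords (D : LinearChordDiagram k n) : Finset (Finset (Fin (k * n))) :=
  D.val.parts

/-- A set of vertices is a set of adjacent vertices if it is an interval `{a, a + 1, …, b - 1}`. -/
def IsConsecutive {N : ℕ} (B : Finset (Fin N)) : Prop :=
  ∃ a b : ℕ, ∀ v : Fin N, v ∈ B ↔ a ≤ (v : ℕ) ∧ (v : ℕ) < b

/-- The short chords of a diagram: the `k`-chords formed on a set of adjacent vertices. -/
def ShortChord (D : LinearChordDiagram k n) : Type :=
  {B : Finset (Fin (k * n)) // B ∈ D.chords ∧ IsConsecutive B}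

/-- The graph on the short chords of a diagram in which two distinct short chords are joined
if some vertex of one of them is next to some vertex of the other one. -/
def shortChordGraph (D : LinearChordDiagram k n) : SimpleGraph D.ShortChord :=
  SimpleGraph.fromRel fun A B => ∃ a ∈ A.val, ∃ b ∈ B.val, (a : ℕ) + 1 = (b : ℕ)

/-- The number of connected components of short chords, that is, of maximal runs
of adjacent short chords. -/
noncomputable def numComponents (D : LinearChordDiagram k n) : ℕ :=
  Nat.card D.shortChordGraph.ConnectedComponent

/-- The probability that a uniformly random linear `k`-chord diagram of length `k * n` has
exactly `q` connected components. -/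
noncomputable def probComponents (k n q : ℕ) : ℝ :=
  (Nat.card {D : LinearChordDiagram k n // D.numComponents = q} : ℝ) /
    (Nat.card (LinearChordDiagram k n) : ℝ)

/-- The `j`-th factorial moment `E[X (X - 1) ⋯ (X - j + 1)]` of the number `X` of connected
components of a uniformly random linear `k`-chord diagram of length `k * n`. -/
noncomputable def factorialMoment (k n j : ℕ) : ℝ :=
  (∑ D : LinearChordDiagram k n, (D.numComponents.descFactorial j : ℝ)) /
    (Nat.card (LinearChordDiagram k n) : ℝ)

/-- The Poisson parameter `λ = k! k^(1-k) n^(2-k)` (integer exponents). -/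
noncomputable def poissonRate (k n : ℕ) : ℝ≥0 :=
  (k ! : ℝ≥0) * (k : ℝ≥0) ^ (1 - (k : ℤ)) * (n : ℝ≥0) ^ (2 - (k : ℤ))

end LinearChordDiagram

/-!
The proof is the method of factorial moments, with Bonferroni truncation at the end.

Let `t n` be the number of partitions of a set of `k * n` elements into blocks of size `k`. Fixing
the block of one element gives `t n = (k * n - 1).choose (k - 1) * t (n - 1)`, and the diagrams
containing `m` prescribed disjoint chords number `t (n - m)`. Hence `m` prescribed disjoint
chords are present with probability `t (n - m) / t n`, which is asymptotic to
`((k - 1)! / (k * n) ^ (k - 1)) ^ m`; as there are about `k * n` positions for a short chord, the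
rate is `k * n * (k - 1)! / (k * n) ^ (k - 1)`, which is `poissonRate k n`.

The number `X` of components lies between the number of short chords that do not directly follow
another short chord (`runStarts`) and the number of all short chords (`shortStarts`). Counting
`j`-element sets of short chords bounds `E[(X)_j]` from above by `(k * n) ^ j * t (n - j) / t n`
(`factorialMoment_le`). For the lower bound (`le_factorialMoment`) only sets of positions with gaps
larger than `k` are counted, which are almost all sets; if such chords do not all start a run, then
one more chord is prescribed, at a cost of a factor `O(n ^ (1 - k))`. Both bounds are asymptotic to
the `j`-th power of the rate (`tendsto_factorialMoment_div`).

For the probabilities, the rate converges to some `L` (`1` if `k = 2`, else `0`). Dividing the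
Bonferroni inequalities by the `q`-th power of the rate makes every term converge, so that the
quotient of `Pr(X = q)` by that power differs in the limit from a partial sum of the series of
`exp (-L) / q!` by at most the next term. This treats the case of a vanishing rate together with
the case `k = 2`.
-/

/-! ### Partitions into blocks of a fixed size -/

section UniformPartitions

open Finset

variable {α : Type*}

/-- `P` is a partition of the finite set `U` into blocks of size `k`. -/
def IsUniformPartition (k : ℕ) (U : Finset α) (P : Finset (Finset α)) : Prop :=
  (∀ B ∈ P, B.card = k ∧ B ⊆ U) ∧ ∀ x ∈ U, ∃! B, B ∈ P ∧ x ∈ B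

lemma IsUniformPartition.eq_of_mem {k : ℕ} {U : Finset α} {P : Finset (Finset α)}
    (h : IsUniformPartition k U P) {A B : Finset α} (hA : A ∈ P) (hB : B ∈ P) {x : α}
    (hxA : x ∈ A) (hxB : x ∈ B) : A = B :=
  (h.2 x ((h.1 A hA).2 hxA)).unique ⟨hA, hxA⟩ ⟨hB, hxB⟩

lemma IsUniformPartition.disjoint {k : ℕ} {U : Finset α} {P : Finset (Finset α)}
    (h : IsUniformPartition k U P) {A B : Finset α} (hA : A ∈ P) (hB : B ∈ P) (hAB : A ≠ B) :
    Disjoint A B :=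
  Finset.disjoint_left.2 fun _ hxA hxB => hAB (h.eq_of_mem hA hB hxA hxB)

open Classical in
/-- The finite set of all partitions of `U` into blocks of size `k`. -/
noncomputable def uniformPartitions (k : ℕ) (U : Finset α) : Finset (Finset (Finset α)) :=
  {P ∈ U.powerset.powerset | IsUniformPartition k U P}

lemma mem_uniformPartitions {k : ℕ} {U : Finset α} {P : Finset (Finset α)} :
    P ∈ uniformPartitions k U ↔ IsUniformPartition k U P := by
  classical
  simp only [uniformPartitions, mem_filter, mem_powerset, and_iff_right_iff_imp]
  exact fun h B hB => mem_powerset.2 (h.1 B hB).2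

variable [DecidableEq α]

lemma IsUniformPartition.erase {k : ℕ} {U : Finset α} {P : Finset (Finset α)}
    (h : IsUniformPartition k U P) {B : Finset α} (hB : B ∈ P) :
    IsUniformPartition k (U \ B) (P.erase B) := by
  refine ⟨fun A hA => ?_, fun x hx => ?_⟩
  · obtain ⟨hAB, hA⟩ := mem_erase.1 hA
    exact ⟨(h.1 A hA).1, subset_sdiff.2 ⟨(h.1 A hA).2, h.disjoint hA hB hAB⟩⟩
  · obtain ⟨hxU, hxB⟩ := mem_sdiff.1 hx
    obtain ⟨A, ⟨hA, hxA⟩, hu⟩ := h.2 x hxU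
    refine ⟨A, ⟨mem_erase.2 ⟨?_, hA⟩, hxA⟩, fun C hC => hu C ⟨(mem_erase.1 hC.1).2, hC.2⟩⟩
    rintro rfl
    exact hxB hxA

lemma IsUniformPartition.insert {k : ℕ} {U B : Finset α} {P : Finset (Finset α)}
    (h : IsUniformPartition k (U \ B) P) (hBk : B.card = k) (hBU : B ⊆ U) :
    IsUniformPartition k U (insert B P) := by
  have hP : ∀ A ∈ P, Disjoint A B := fun A hA => (subset_sdiff.1 (h.1 A hA).2).2
  refine ⟨fun A hA => ?_, fun x hx => ?_⟩
  · obtain rfl | hA := mem_insert.1 hA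
    · exact ⟨hBk, hBU⟩
    · exact ⟨(h.1 A hA).1, (h.1 A hA).2.trans sdiff_subset⟩
  · by_cases hxB : x ∈ B
    · refine ⟨B, ⟨mem_insert_self _ _, hxB⟩, ?_⟩
      rintro C ⟨hC, hxC⟩
      obtain rfl | hC := mem_insert.1 hC
      · rfl
      · exact absurd hxB (Finset.disjoint_left.1 (hP C hC) hxC)
    · obtain ⟨A, ⟨hA, hxA⟩, hu⟩ := h.2 x (mem_sdiff.2 ⟨hx, hxB⟩)
      refine ⟨A, ⟨mem_insert_of_mem hA, hxA⟩, ?_⟩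
      rintro C ⟨hC, hxC⟩
      obtain rfl | hC := mem_insert.1 hC
      · exact absurd hxC hxB
      · exact hu C ⟨hC, hxC⟩

/-- Deleting the block `B` is a bijection from the partitions of `U` that contain `B` onto the
partitions of `U \ B`. -/
lemma card_uniformPartitions_insert_subset {k : ℕ} (hk : 0 < k) {U B : Finset α}
    (hBk : B.card = k) (hBU : B ⊆ U) {F : Finset (Finset α)} (hBF : B ∉ F) :
    #{P ∈ uniformPartitions k U | insert B F ⊆ P} =
      #{P ∈ uniformPartitions k (U \ B) | F ⊆ P} := by
  have hB0 : B.Nonempty := card_pos.1 (hBk ▸ hk)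
  have hnot : ∀ P, IsUniformPartition k (U \ B) P → B ∉ P := by
    intro P hP hBP
    obtain ⟨x, hx⟩ := hB0
    exact (mem_sdiff.1 ((hP.1 B hBP).2 hx)).2 hx
  refine card_nbij' (fun P => P.erase B) (fun P => insert B P) ?_ ?_ ?_ ?_
  · intro P hP
    simp only [coe_filter, mem_uniformPartitions, Set.mem_ofPred_eq, insert_subset_iff] at hP ⊢
    exact ⟨hP.1.erase hP.2.1, subset_erase.2 ⟨hP.2.2, hBF⟩⟩
  · intro P hP
    simp only [coe_filter, mem_uniformPartitions, Set.mem_ofPred_eq, insert_subset_iff] at hP ⊢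
    exact ⟨hP.1.insert hBk hBU, mem_insert_self _ _, hP.2.trans (subset_insert _ _)⟩
  · intro P hP
    simp only [coe_filter, Set.mem_ofPred_eq, insert_subset_iff] at hP
    exact insert_erase hP.2.1
  · intro P hP
    simp only [coe_filter, mem_uniformPartitions, Set.mem_ofPred_eq] at hP
    exact erase_insert (hnot P hP.1)

lemma card_uniformPartitions_mem {k : ℕ} (hk : 0 < k) {U B : Finset α}
    (hBk : B.card = k) (hBU : B ⊆ U) :
    #{P ∈ uniformPartitions k U | B ∈ P} = #(uniformPartitions k (U \ B)) := by
  simpa using card_uniformPartitions_insert_subset hk hBk hBU (notMem_empty B)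

/-- The number of partitions of a set of `k * n` elements into blocks of size `k`, by the
recursion that chooses the block of a given element. -/
def numUniformPartitions (k : ℕ) : ℕ → ℕ
  | 0 => 1
  | n + 1 => (k * n + k - 1).choose (k - 1) * numUniformPartitions k n

lemma numUniformPartitions_pos {k : ℕ} (n : ℕ) : 0 < numUniformPartitions k n := by
  induction n with
  | zero => exact Nat.one_pos
  | succ n ih => exact Nat.mul_pos (Nat.choose_pos (by grind)) ih

lemma card_filter_mem_powersetCard {k : ℕ} {U : Finset α} {a : α} (ha : a ∈ U) :
    #{B ∈ U.powersetCard (k + 1) | a ∈ B} = (#U - 1).choose k := by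
  rw [← card_erase_of_mem ha, ← card_powersetCard]
  refine card_nbij' (fun B => B.erase a) (fun B => insert a B) ?_ ?_ ?_ ?_
  · intro B hB
    simp only [coe_filter, mem_powersetCard, Set.mem_ofPred_eq, mem_coe] at hB ⊢
    exact ⟨erase_subset_erase _ hB.1.1, by rw [card_erase_of_mem hB.2, hB.1.2]; rfl⟩
  · intro B hB
    simp only [coe_filter, mem_powersetCard, Set.mem_ofPred_eq, mem_coe, subset_erase] at hB ⊢
    exact ⟨⟨insert_subset ha hB.1.1, by rw [card_insert_of_notMem hB.1.2, hB.2]⟩,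
      mem_insert_self _ _⟩
  · intro B hB
    simp only [coe_filter, Set.mem_ofPred_eq] at hB
    exact insert_erase hB.2
  · intro B hB
    simp only [mem_powersetCard, mem_coe, subset_erase] at hB
    exact erase_insert hB.1.2

lemma card_uniformPartitions {k : ℕ} (hk : 0 < k) (n : ℕ) {U : Finset α} (hU : #U = k * n) :
    #(uniformPartitions k U) = numUniformPartitions k n := by
  induction n generalizing U with
  | zero =>
    obtain rfl : U = ∅ := card_eq_zero.1 (by simpa using hU)
    have : uniformPartitions k (∅ : Finset α) = {∅} := by
      ext P
      rw [mem_uniformPartitions, mem_singleton]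
      constructor
      · intro h
        refine eq_empty_of_forall_notMem fun B hB => ?_
        obtain ⟨h1, h2⟩ := h.1 B hB
        rw [subset_empty.1 h2, card_empty] at h1
        omega
      · rintro rfl
        exact ⟨by simp, by simp⟩
    rw [this]
    rfl
  | succ n ih =>
    obtain ⟨a, ha⟩ : U.Nonempty := card_pos.1 (hU ▸ by positivity)
    obtain ⟨l, rfl⟩ : ∃ l, k = l + 1 := ⟨k - 1, by omega⟩
    set V := {B ∈ U.powersetCard (l + 1) | a ∈ B} with hV
    have h1 : ∀ B ∈ V, #{P ∈ uniformPartitions (l + 1) U | B ∈ P} =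
        numUniformPartitions (l + 1) n := by
      intro B hB
      simp only [hV, mem_filter, mem_powersetCard] at hB
      rw [card_uniformPartitions_mem hk hB.1.2 hB.1.1]
      apply ih
      rw [card_sdiff_of_subset hB.1.1, hU, hB.1.2, Nat.mul_succ, Nat.add_sub_cancel]
    have h2 : ∀ P ∈ uniformPartitions (l + 1) U, #{B ∈ V | B ∈ P} = 1 := by
      intro P hP
      rw [mem_uniformPartitions] at hP
      obtain ⟨B, ⟨hB, haB⟩, hu⟩ := hP.2 a ha
      refine card_eq_one.2 ⟨B, ext fun C => ?_⟩
      simp only [hV, mem_filter, mem_powersetCard, mem_singleton]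
      constructor
      · rintro ⟨⟨_, h⟩, h'⟩
        exact hu C ⟨h', h⟩
      · rintro rfl
        exact ⟨⟨⟨(hP.1 C hB).2, (hP.1 C hB).1⟩, haB⟩, hB⟩
    have h3 := sum_card_bipartiteAbove_eq_sum_card_bipartiteBelow
      (s := V) (t := uniformPartitions (l + 1) U) (fun B P => B ∈ P)
    simp only [bipartiteAbove, bipartiteBelow] at h3
    rw [sum_congr rfl h1, sum_congr rfl h2, sum_const, sum_const, smul_eq_mul, smul_eq_mul,
      mul_one, hV, card_filter_mem_powersetCard ha, hU] at h3
    rw [← h3]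
    rfl

/-- Prescribing pairwise disjoint blocks leaves a partition of the remaining elements. -/
lemma card_uniformPartitions_subset {k : ℕ} (hk : 0 < k) {n : ℕ} {U : Finset α}
    (hU : #U = k * n) {F : Finset (Finset α)} (hF : ∀ B ∈ F, #B = k ∧ B ⊆ U)
    (hdisj : (F : Set (Finset α)).PairwiseDisjoint id) :
    #{P ∈ uniformPartitions k U | F ⊆ P} = numUniformPartitions k (n - #F) := by
  induction F using Finset.induction_on generalizing U n with
  | empty => simpa using card_uniformPartitions hk n hU
  | insert B F hBF ih =>
    obtain ⟨hBk, hBU⟩ := hF B (mem_insert_self _ _)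
    rw [card_uniformPartitions_insert_subset hk hBk hBU hBF, card_insert_of_notMem hBF,
      Nat.add_comm, ← Nat.sub_sub]
    apply ih
    · rw [card_sdiff_of_subset hBU, hU, hBk, Nat.mul_sub, mul_one]
    · intro A hA
      refine ⟨(hF A (mem_insert_of_mem hA)).1, subset_sdiff.2 ⟨(hF A (mem_insert_of_mem hA)).2, ?_⟩⟩
      exact hdisj (mem_coe.2 (mem_insert_of_mem hA)) (mem_coe.2 (mem_insert_self _ _))
        (by rintro rfl; exact hBF hA)
    · exact hdisj.subset (by simp)

lemma card_uniformPartitions_subset_le {k : ℕ} (hk : 0 < k) {n : ℕ} {U : Finset α}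
    (hU : #U = k * n) (F : Finset (Finset α)) :
    #{P ∈ uniformPartitions k U | F ⊆ P} ≤ numUniformPartitions k (n - #F) := by
  obtain h | ⟨P, hP⟩ := eq_empty_or_nonempty {P ∈ uniformPartitions k U | F ⊆ P}
  · simp [h]
  · obtain ⟨hP, hFP⟩ := mem_filter.1 hP
    rw [mem_uniformPartitions] at hP
    exact (card_uniformPartitions_subset hk hU (fun B hB => hP.1 B (hFP hB))
      fun A hA B hB hAB => hP.disjoint (hFP hA) (hFP hB) hAB).le

end UniformPartitions

/-! ### Short chords and the number of components -/

namespace LinearChordDiagram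

open Finset

variable {k n : ℕ}

lemma chords_injective : Function.Injective (chords : LinearChordDiagram k n → _) :=
  fun _ _ h => Subtype.ext (Finpartition.ext h)

lemma isUniformPartition_chords (D : LinearChordDiagram k n) :
    IsUniformPartition k univ D.chords :=
  ⟨fun B hB => ⟨D.2 B hB, subset_univ B⟩, fun _ hx => D.1.existsUnique_mem hx⟩

lemma exists_chords_eq (hk : 0 < k) {P : Finset (Finset (Fin (k * n)))}
    (hP : IsUniformPartition k univ P) : ∃ D : LinearChordDiagram k n, D.chords = P := by
  refine ⟨⟨Finpartition.ofExistsUnique P (fun B hB => (hP.1 B hB).2) hP.2 ?_, ?_⟩, rfl⟩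
  · intro h
    have := (hP.1 ∅ h).1
    rw [card_empty] at this
    omega
  · exact fun B hB => (hP.1 B hB).1

open Classical in
lemma card_filter_chords (hk : 0 < k) (p : Finset (Finset (Fin (k * n))) → Prop) :
    #{D : LinearChordDiagram k n | p D.chords} = #{P ∈ uniformPartitions k univ | p P} := by
  rw [← card_map ⟨chords, chords_injective⟩]
  congr 1
  ext P
  simp only [mem_map, mem_filter, mem_univ, true_and, Function.Embedding.coeFn_mk,
    mem_uniformPartitions]
  constructor
  · rintro ⟨D, hD, rfl⟩
    exact ⟨D.isUniformPartition_chords, hD⟩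
  · rintro ⟨hP, hp⟩
    obtain ⟨D, rfl⟩ := exists_chords_eq hk hP
    exact ⟨D, hp, rfl⟩

lemma card_eq_numUniformPartitions (hk : 0 < k) (n : ℕ) :
    Nat.card (LinearChordDiagram k n) = numUniformPartitions k n := by
  classical
  have h := card_filter_chords (n := n) hk (fun _ => True)
  rw [filter_true, filter_true, card_uniformPartitions hk n (by simp)] at h
  rw [Nat.card_eq_fintype_card, ← h, card_univ]

/-- The set of the `k` consecutive vertices `p, …, p + k - 1`, cut off at the last vertex. -/
def interval (N k p : ℕ) : Finset (Fin N) :=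
  {v | p ≤ (v : ℕ) ∧ (v : ℕ) < p + k}

lemma mem_interval {N k p : ℕ} {v : Fin N} :
    v ∈ interval N k p ↔ p ≤ (v : ℕ) ∧ (v : ℕ) < p + k := by
  simp [interval]

lemma card_eq_sub_of_mem_iff {N a b : ℕ} {B : Finset (Fin N)} (hb : b ≤ N)
    (h : ∀ v : Fin N, v ∈ B ↔ a ≤ (v : ℕ) ∧ (v : ℕ) < b) : #B = b - a := by
  rw [← Nat.card_Ico, ← card_map Fin.valEmbedding]
  congr 1
  ext x
  simp only [mem_map, h, Fin.valEmbedding_apply, mem_Ico]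
  constructor
  · rintro ⟨v, hv, rfl⟩
    exact hv
  · exact fun hx => ⟨⟨x, by omega⟩, hx, rfl⟩

lemma card_interval {N k p : ℕ} (h : p + k ≤ N) : #(interval N k p) = k := by
  rw [card_eq_sub_of_mem_iff h fun v => mem_interval, Nat.add_sub_cancel_left]

lemma isConsecutive_interval (N k p : ℕ) : IsConsecutive (interval N k p) :=
  ⟨p, p + k, fun _ => mem_interval⟩

lemma IsConsecutive.exists_eq_interval {N k : ℕ} (hk : 0 < k) {B : Finset (Fin N)}
    (hB : IsConsecutive B) (hc : #B = k) : ∃ p, p + k ≤ N ∧ B = interval N k p := by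
  obtain ⟨a, b, h⟩ := hB
  have h' : ∀ v : Fin N, v ∈ B ↔ a ≤ (v : ℕ) ∧ (v : ℕ) < min b N := by
    intro v
    rw [h, lt_min_iff]
    simp
  have hcard := card_eq_sub_of_mem_iff (min_le_right b N) h'
  refine ⟨a, by omega, ext fun v => ?_⟩
  rw [h', mem_interval]
  omega

lemma interval_inj {N k p q : ℕ} (hk : 0 < k) (hp : p + k ≤ N) (hq : q + k ≤ N)
    (h : interval N k p = interval N k q) : p = q := by
  have h1 : (⟨p, by omega⟩ : Fin N) ∈ interval N k q := h ▸ mem_interval.2 ⟨le_rfl, by simpa⟩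
  have h2 : (⟨q, by omega⟩ : Fin N) ∈ interval N k p := h ▸ mem_interval.2 ⟨le_rfl, by simpa⟩
  rw [mem_interval] at h1 h2
  exact le_antisymm h2.1 h1.1

/-- The set of the first vertices of the short chords. The bound on `p` excludes intervals that
are cut off at the last vertex. -/
def shortStarts (D : LinearChordDiagram k n) : Finset ℕ :=
  {p ∈ range (k * n + 1 - k) | interval (k * n) k p ∈ D.chords}

/-- The set of the first vertices of the maximal runs of adjacent short chords, that is, of the
short chords that do not directly follow another short chord. -/
def runStarts (D : LinearChordDiagram k n) : Finset ℕ :=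
  {p ∈ D.shortStarts | ∀ q ∈ D.shortStarts, q + k ≠ p}

lemma mem_shortStarts {D : LinearChordDiagram k n} {p : ℕ} :
    p ∈ D.shortStarts ↔ p + k ≤ k * n ∧ interval (k * n) k p ∈ D.chords := by
  simp only [shortStarts, mem_filter, mem_range]
  refine and_congr_left fun _ => ?_
  omega

/-- The short chord with a given first vertex. -/
def shortChordOfStart (D : LinearChordDiagram k n) (p : D.shortStarts) : D.ShortChord :=
  ⟨interval (k * n) k p, (mem_filter.1 p.2).2, isConsecutive_interval _ _ _⟩

lemma shortChordOfStart_surjective (hk : 0 < k) (D : LinearChordDiagram k n) :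
    Function.Surjective D.shortChordOfStart := by
  rintro ⟨B, hB, hc⟩
  obtain ⟨p, hp, rfl⟩ := hc.exists_eq_interval hk (D.2 B hB)
  exact ⟨⟨p, mem_shortStarts.2 ⟨hp, hB⟩⟩, rfl⟩

instance (D : LinearChordDiagram k n) : Finite D.ShortChord :=
  inferInstanceAs (Finite {B : Finset (Fin (k * n)) // B ∈ D.chords ∧ IsConsecutive B})

lemma numComponents_le_card_shortStarts (hk : 0 < k) (D : LinearChordDiagram k n) :
    D.numComponents ≤ #D.shortStarts := by
  have h : Function.Surjective fun p => D.shortChordGraph.connectedComponentMk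
      (D.shortChordOfStart p) :=
    Quot.mk_surjective.comp (D.shortChordOfStart_surjective hk)
  simpa [numComponents] using Nat.card_le_card_of_surjective _ h

/-- A path of short chords that begins to the right of the start `p` of a run never gets to the
left of `p`: a chord on its left that is adjacent to one on its right would directly precede the
chord starting at `p`. -/
lemma le_of_adj_of_mem_runStarts (hk : 0 < k) {D : LinearChordDiagram k n} {p : ℕ}
    (hp : p ∈ D.runStarts) {c d : D.shortStarts}
    (h : D.shortChordGraph.Adj (D.shortChordOfStart c) (D.shortChordOfStart d))
    (hc : p ≤ c) : p ≤ d := by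
  obtain ⟨c, hcS⟩ := c
  obtain ⟨d, hdS⟩ := d
  obtain ⟨hpS, hpR⟩ := mem_filter.1 hp
  have hp' := mem_shortStarts.1 hpS
  have hd' := mem_shortStarts.1 hdS
  by_contra! hlt
  simp only at hc hlt
  have hdp : d + k ≤ p := by
    by_contra! hlt'
    have := D.isUniformPartition_chords.eq_of_mem hd'.2 hp'.2 (x := ⟨p, by omega⟩)
      (mem_interval.2 ⟨hlt.le, hlt'⟩) (mem_interval.2 ⟨le_rfl, by simpa⟩)
    have := interval_inj hk hd'.1 hp'.1 this
    omega
  have hne := hpR d hdS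
  obtain ⟨-, ⟨a, ha, b, hb, hab⟩ | ⟨a, ha, b, hb, hab⟩⟩ := (SimpleGraph.fromRel_adj _ _ _).1 h
  · have h1 : c ≤ (a : ℕ) ∧ _ := mem_interval.1 ha
    have h2 : _ ∧ (b : ℕ) < d + k := mem_interval.1 hb
    omega
  · have h1 : _ ∧ (a : ℕ) < d + k := mem_interval.1 ha
    have h2 : c ≤ (b : ℕ) ∧ _ := mem_interval.1 hb
    omega

lemma le_of_reachable_of_mem_runStarts (hk : 0 < k) {D : LinearChordDiagram k n} {p : ℕ}
    (hp : p ∈ D.runStarts) {c d : D.shortStarts}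
    (h : D.shortChordGraph.Reachable (D.shortChordOfStart c) (D.shortChordOfStart d))
    (hc : p ≤ c) : p ≤ d := by
  have key : ∀ B, Relation.ReflTransGen D.shortChordGraph.Adj (D.shortChordOfStart c) B →
      ∃ d : D.shortStarts, p ≤ d ∧ D.shortChordOfStart d = B := by
    intro B hB
    induction hB with
    | refl => exact ⟨c, hc, rfl⟩
    | @tail _ C _ hadj ih =>
      obtain ⟨d, hd, rfl⟩ := ih
      obtain ⟨e, rfl⟩ := D.shortChordOfStart_surjective hk C
      exact ⟨e, le_of_adj_of_mem_runStarts hk hp hadj hd, rfl⟩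
  obtain ⟨e, he, hed⟩ := key _ ((SimpleGraph.reachable_iff_reflTransGen _ _).1 h)
  have := interval_inj hk (mem_shortStarts.1 e.2).1 (mem_shortStarts.1 d.2).1
    (congrArg Subtype.val hed)
  omega

lemma card_runStarts_le_numComponents (hk : 0 < k) (D : LinearChordDiagram k n) :
    #D.runStarts ≤ D.numComponents := by
  have hsub : ∀ p : D.runStarts, (p : ℕ) ∈ D.shortStarts := fun p => (mem_filter.1 p.2).1
  have h : Function.Injective fun p : D.runStarts =>
      D.shortChordGraph.connectedComponentMk (D.shortChordOfStart ⟨p, hsub p⟩) := by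
    intro p q hpq
    have hr := SimpleGraph.ConnectedComponent.eq.1 hpq
    exact Subtype.ext (le_antisymm (le_of_reachable_of_mem_runStarts hk p.2 hr le_rfl)
      (le_of_reachable_of_mem_runStarts hk q.2 hr.symm le_rfl))
  simpa [numComponents] using Nat.card_le_card_of_injective _ h

/-! ### Bounds for the binomial moments -/

lemma subset_shortStarts_iff {D : LinearChordDiagram k n} {J : Finset ℕ}
    (hJ : ∀ p ∈ J, p + k ≤ k * n) :
    J ⊆ D.shortStarts ↔ J.image (interval (k * n) k) ⊆ D.chords := by
  rw [image_subset_iff]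
  exact forall₂_congr fun p hp => by rw [mem_shortStarts, and_iff_right (hJ p hp)]

lemma card_image_interval (hk : 0 < k) {J : Finset ℕ} (hJ : ∀ p ∈ J, p + k ≤ k * n) :
    #(J.image (interval (k * n) k)) = #J :=
  card_image_of_injOn fun p hp q hq h => interval_inj hk (hJ p hp) (hJ q hq) h

lemma card_subset_shortStarts_le (hk : 0 < k) (J : Finset ℕ) :
    #{D : LinearChordDiagram k n | J ⊆ D.shortStarts} ≤ numUniformPartitions k (n - #J) := by
  classical
  by_cases hJ : ∀ p ∈ J, p + k ≤ k * n
  · simp_rw [subset_shortStarts_iff hJ]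
    rw [← card_image_interval hk hJ]
    refine le_of_eq_of_le ?_ (card_uniformPartitions_subset_le hk
      (U := (univ : Finset (Fin (k * n)))) (by simp) _)
    convert card_filter_chords hk fun P => J.image (interval (k * n) k) ⊆ P
  · rw [filter_false_of_mem, card_empty]
    · exact Nat.zero_le _
    · exact fun D _ h => hJ fun p hp => (mem_shortStarts.1 (h hp)).1

/-- Any two distinct elements of `J` differ by more than `d`. -/
def IsSeparated (d : ℕ) (J : Finset ℕ) : Prop :=
  ∀ p ∈ J, ∀ q ∈ J, p < q → p + d < q

lemma card_subset_shortStarts (hk : 0 < k) {J : Finset ℕ} (hJ : ∀ p ∈ J, p + k ≤ k * n)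
    (hs : IsSeparated k J) :
    #{D : LinearChordDiagram k n | J ⊆ D.shortStarts} = numUniformPartitions k (n - #J) := by
  classical
  simp_rw [subset_shortStarts_iff hJ]
  rw [← card_image_interval hk hJ]
  refine Eq.trans ?_ (card_uniformPartitions_subset hk
    (U := (univ : Finset (Fin (k * n)))) (n := n) (by simp) ?_ ?_)
  · convert card_filter_chords hk fun P => J.image (interval (k * n) k) ⊆ P
  · intro B hB
    obtain ⟨p, hp, rfl⟩ := mem_image.1 hB
    exact ⟨card_interval (hJ p hp), subset_univ _⟩
  · intro A hA B hB hAB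
    obtain ⟨p, hp, rfl⟩ := mem_image.1 hA
    obtain ⟨q, hq, rfl⟩ := mem_image.1 hB
    refine Finset.disjoint_left.2 fun v hv hv' => ?_
    simp only [id, mem_interval] at hv hv'
    rcases lt_trichotomy p q with h | rfl | h
    · have := hs p hp q hq h
      omega
    · exact hAB rfl
    · have := hs q hq p hp h
      omega

/-- Each `j`-element set of positions of short chords is realized by at most `t (n - j)`
diagrams, where `t = numUniformPartitions k`. -/
lemma sum_choose_numComponents_le (hk : 0 < k) (n j : ℕ) :
    ∑ D : LinearChordDiagram k n, D.numComponents.choose j ≤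
      (k * n).choose j * numUniformPartitions k (n - j) := by
  classical
  calc ∑ D : LinearChordDiagram k n, D.numComponents.choose j
      ≤ ∑ D : LinearChordDiagram k n, #{J ∈ (range (k * n)).powersetCard j | J ⊆ D.shortStarts} := by
        refine sum_le_sum fun D _ => ?_
        refine (Nat.choose_le_choose j (D.numComponents_le_card_shortStarts hk)).trans ?_
        rw [← card_powersetCard]
        refine card_le_card fun J hJ => ?_
        obtain ⟨hJ, hJc⟩ := mem_powersetCard.1 hJ
        refine mem_filter.2 ⟨mem_powersetCard.2 ⟨fun p hp => ?_, hJc⟩, hJ⟩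
        have := (mem_shortStarts.1 (hJ hp)).1
        exact mem_range.2 (by omega)
    _ = ∑ J ∈ (range (k * n)).powersetCard j,
          #{D : LinearChordDiagram k n | J ⊆ D.shortStarts} :=
        sum_card_bipartiteAbove_eq_sum_card_bipartiteBelow _
    _ ≤ ∑ J ∈ (range (k * n)).powersetCard j, numUniformPartitions k (n - j) := by
        refine sum_le_sum fun J hJ => ?_
        have := card_subset_shortStarts_le (n := n) hk J
        rwa [(mem_powersetCard.1 hJ).2] at this
    _ = _ := by rw [sum_const, card_powersetCard, card_range, smul_eq_mul]

open Classical in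
/-- The `j`-element subsets of `{0, …, N - 1}` whose elements differ by more than `d`. -/
noncomputable def separatedSets (d N j : ℕ) : Finset (Finset ℕ) :=
  {J ∈ (range N).powersetCard j | IsSeparated d J}

lemma mem_separatedSets {d N j : ℕ} {J : Finset ℕ} :
    J ∈ separatedSets d N j ↔ (J ⊆ range N ∧ #J = j) ∧ IsSeparated d J := by
  simp [separatedSets]

/-- Given short chords at the positions in a separated set `J`, either all of them start a run, or
some chord directly preceding one of them is also short; the latter prescribes one more chord. -/
lemma card_mul_le_sum_choose_numComponents (hk : 0 < k) (n j : ℕ) :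
    #(separatedSets k (k * n + 1 - k) j) * numUniformPartitions k (n - j) ≤
      ∑ D : LinearChordDiagram k n, D.numComponents.choose j +
        #(separatedSets k (k * n + 1 - k) j) * (j * numUniformPartitions k (n - (j + 1))) := by
  classical
  set F := separatedSets k (k * n + 1 - k) j with hF
  have h1 : ∀ J ∈ F, numUniformPartitions k (n - j) ≤
      #{D : LinearChordDiagram k n | J ⊆ D.runStarts} +
        j * numUniformPartitions k (n - (j + 1)) := by
    intro J hJ
    obtain ⟨⟨hJN, hJc⟩, hs⟩ := mem_separatedSets.1 hJ
    have hJ' : ∀ p ∈ J, p + k ≤ k * n := fun p hp => by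
      have := mem_range.1 (hJN hp)
      omega
    have hsub : ({D | J ⊆ D.shortStarts} : Finset (LinearChordDiagram k n)) ⊆
        ({D | J ⊆ D.runStarts} : Finset (LinearChordDiagram k n)) ∪
          J.biUnion fun p => {D | k ≤ p ∧ insert (p - k) J ⊆ D.shortStarts} := by
      intro D hD
      simp only [mem_filter, mem_univ, true_and, mem_union, mem_biUnion] at hD ⊢
      by_contra! h
      refine h.1 fun p hp => mem_filter.2 ⟨hD hp, ?_⟩
      rintro q hq rfl
      exact h.2 (q + k) hp (by omega) (insert_subset (by simpa using hq) hD)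
    rw [← hJc, ← card_subset_shortStarts hk hJ' hs]
    refine (card_le_card hsub).trans ((card_union_le _ _).trans ?_)
    refine Nat.add_le_add_left (card_biUnion_le_card_mul _ _ _ fun p hp => ?_) _
    by_cases hpk : k ≤ p
    · have hnot : p - k ∉ J := fun h => by
        have := hs _ h p hp (by omega)
        omega
      have := card_subset_shortStarts_le (n := n) hk (insert (p - k) J)
      rw [card_insert_of_notMem hnot] at this
      simpa [hpk] using this
    · simp [hpk]
  calc #F * numUniformPartitions k (n - j)
      = ∑ J ∈ F, numUniformPartitions k (n - j) := by rw [sum_const, smul_eq_mul]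
    _ ≤ ∑ J ∈ F, (#{D : LinearChordDiagram k n | J ⊆ D.runStarts} +
          j * numUniformPartitions k (n - (j + 1))) := sum_le_sum h1
    _ = ∑ J ∈ F, #{D : LinearChordDiagram k n | J ⊆ D.runStarts} +
          #F * (j * numUniformPartitions k (n - (j + 1))) := by
        rw [sum_add_distrib, sum_const, smul_eq_mul]
    _ ≤ _ := by
        refine Nat.add_le_add_right ?_ _
        refine (sum_card_bipartiteAbove_eq_sum_card_bipartiteBelow
          (fun (J : Finset ℕ) (D : LinearChordDiagram k n) => J ⊆ D.runStarts)).trans_le ?_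
        refine sum_le_sum fun D _ => ?_
        refine le_trans ?_ (Nat.choose_le_choose j (D.card_runStarts_le_numComponents hk))
        rw [← card_powersetCard]
        refine card_le_card fun J hJ => ?_
        obtain ⟨hJ, hJD⟩ := mem_filter.1 hJ
        exact mem_powersetCard.2 ⟨hJD, (mem_separatedSets.1 hJ).1.2⟩

/-- Every separated set of `j` elements rules out at most `j * (2 * d + 1)` further elements. -/
lemma card_separatedSets_mul_le (d N j : ℕ) :
    #(separatedSets d N j) * (N - j * (2 * d + 1)) ≤ #(separatedSets d N (j + 1)) * (j + 1) := by
  classical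
  have hext : ∀ J ∈ separatedSets d N j,
      N - j * (2 * d + 1) ≤ #(range N \ J.biUnion fun p => Icc (p - d) (p + d)) := by
    intro J hJ
    refine le_trans ?_ (le_card_sdiff _ _)
    rw [card_range]
    refine Nat.sub_le_sub_left ?_ N
    rw [← (mem_separatedSets.1 hJ).1.2]
    refine card_biUnion_le_card_mul _ _ _ fun p _ => ?_
    rw [Nat.card_Icc]
    omega
  have hnot : ∀ J : Finset ℕ, ∀ x ∈ range N \ J.biUnion (fun p => Icc (p - d) (p + d)),
      x ∈ range N ∧ ∀ p ∈ J, p + d < x ∨ x + d < p := by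
    intro J x hx
    simp only [mem_sdiff, mem_biUnion, mem_Icc, not_exists, not_and] at hx
    refine ⟨hx.1, fun p hp => ?_⟩
    have := hx.2 p hp
    omega
  calc #(separatedSets d N j) * (N - j * (2 * d + 1))
      = ∑ J ∈ separatedSets d N j, (N - j * (2 * d + 1)) := by rw [sum_const, smul_eq_mul]
    _ ≤ ∑ J ∈ separatedSets d N j, #(range N \ J.biUnion fun p => Icc (p - d) (p + d)) :=
        sum_le_sum hext
    _ = #((separatedSets d N j).sigma fun J =>
          range N \ J.biUnion fun p => Icc (p - d) (p + d)) := (card_sigma _ _).symm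
    _ ≤ #((separatedSets d N (j + 1)).sigma fun J => J) := by
        refine card_le_card_of_injOn (fun x => ⟨insert x.2 x.1, x.2⟩) ?_ ?_
        · rintro ⟨J, x⟩ hx
          obtain ⟨hJ, hx⟩ := mem_sigma.1 (mem_coe.1 hx)
          obtain ⟨⟨hJN, hJc⟩, hs⟩ := mem_separatedSets.1 hJ
          obtain ⟨hxN, hxJ⟩ := hnot J x hx
          have hxJ' : x ∉ J := fun h => by have := hxJ x h; omega
          refine mem_coe.2 (mem_sigma.2 ⟨mem_separatedSets.2 ⟨⟨insert_subset hxN hJN, ?_⟩, ?_⟩,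
            mem_insert_self _ _⟩)
          · rw [card_insert_of_notMem hxJ', hJc]
          · intro p hp q hq hpq
            change p ∈ insert x J at hp
            change q ∈ insert x J at hq
            rcases mem_insert.1 hp with hp | hp <;> rcases mem_insert.1 hq with hq | hq
            · omega
            · have := hxJ q hq
              omega
            · have := hxJ p hp
              omega
            · exact hs p hp q hq hpq
        · rintro ⟨J, x⟩ hx ⟨J', x'⟩ hx' h
          obtain ⟨-, hx⟩ := mem_sigma.1 (mem_coe.1 hx)
          obtain ⟨-, hx'⟩ := mem_sigma.1 (mem_coe.1 hx')
          simp only [Sigma.mk.injEq, heq_eq_eq] at h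
          obtain ⟨hJ, rfl⟩ := h
          have h1 : x ∉ J := fun h => by have := (hnot J x hx).2 x h; omega
          have h2 : x ∉ J' := fun h => by have := (hnot J' x hx').2 x h; omega
          rw [← erase_insert h1, hJ, erase_insert h2]
    _ = ∑ J ∈ separatedSets d N (j + 1), #J := card_sigma _ _
    _ = #(separatedSets d N (j + 1)) * (j + 1) :=
        sum_const_nat fun J hJ => (mem_separatedSets.1 hJ).1.2

/-- The fixed bound `m` on `j` allows the same base in every step of the induction. -/
lemma pow_le_factorial_mul_card_separatedSets (d N m : ℕ) {j : ℕ} (hj : j ≤ m) :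
    (N - m * (2 * d + 1)) ^ j ≤ j ! * #(separatedSets d N j) := by
  induction j with
  | zero =>
    have : ∅ ∈ separatedSets d N 0 := mem_separatedSets.2 (by simp [IsSeparated])
    simpa using card_pos.2 ⟨_, this⟩
  | succ j ih =>
    have h := card_separatedSets_mul_le d N j
    have hle : N - m * (2 * d + 1) ≤ N - j * (2 * d + 1) :=
      Nat.sub_le_sub_left (Nat.mul_le_mul_right _ (by omega)) _
    calc (N - m * (2 * d + 1)) ^ (j + 1)
        = (N - m * (2 * d + 1)) ^ j * (N - m * (2 * d + 1)) := pow_succ _ _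
      _ ≤ j ! * #(separatedSets d N j) * (N - j * (2 * d + 1)) :=
          Nat.mul_le_mul (ih (by omega)) hle
      _ ≤ j ! * (#(separatedSets d N (j + 1)) * (j + 1)) := by
          rw [mul_assoc]
          exact Nat.mul_le_mul_left _ h
      _ = (j + 1)! * #(separatedSets d N (j + 1)) := by
          rw [Nat.factorial_succ]
          ring

end LinearChordDiagram

/-! ### Asymptotics of the number of uniform partitions -/

section Asymptotics

open Filter Topology

/-- Fixing one block multiplies the number of partitions by
`1 / (k * n - 1).choose (k - 1) ∼ (k - 1)! / (k * n) ^ (k - 1)`. -/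
lemma tendsto_numUniformPartitions_pred_div {k : ℕ} (hk : 0 < k) :
    Tendsto (fun n : ℕ => (numUniformPartitions k (n - 1) : ℝ) / numUniformPartitions k n *
      (n : ℝ) ^ (k - 1)) atTop (𝓝 ((k - 1)! / (k : ℝ) ^ (k - 1))) := by
  obtain ⟨l, rfl⟩ : ∃ l, k = l + 1 := ⟨k - 1, by omega⟩
  rw [← tendsto_add_atTop_iff_nat 1]
  simp only [Nat.add_sub_cancel]
  have hm : Tendsto (fun n : ℕ => (l + 1) * n + l) atTop atTop :=
    tendsto_atTop_mono (fun n => by rw [id]; nlinarith [Nat.zero_le (l * n)]) tendsto_id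
  have h1 : Tendsto (fun n : ℕ => (n.choose l : ℝ) / ((n : ℝ) ^ l / l !)) atTop (𝓝 1) := by
    refine (Asymptotics.isEquivalent_iff_tendsto_one ?_).1 (isEquivalent_choose l)
    filter_upwards [eventually_gt_atTop 0] with n hn
    positivity
  have h2 : Tendsto (fun n : ℕ => ((n : ℝ) + 1) / (((l + 1) * n + l : ℕ) : ℝ)) atTop
      (𝓝 (1 / ((l : ℝ) + 1))) := by
    have h3 : Tendsto (fun n : ℕ => (1 : ℝ) / ((l + 1) - 1 / ((n : ℝ) + 1))) atTop
        (𝓝 (1 / ((l + 1) - 0))) :=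
      tendsto_const_nhds.div (tendsto_const_nhds.sub tendsto_one_div_add_atTop_nhds_zero_nat)
        (by rw [sub_zero]; positivity)
    rw [sub_zero] at h3
    refine h3.congr fun n => ?_
    have hn : (n : ℝ) + 1 ≠ 0 := by positivity
    rw [show ((l : ℝ) + 1) - 1 / ((n : ℝ) + 1) = (((l + 1) * n + l : ℕ) : ℝ) / ((n : ℝ) + 1) by
      push_cast
      field_simp
      ring, one_div_div]
  have h4 := (h2.pow l).mul ((h1.comp hm).inv₀ one_ne_zero)
  have h5 := h4.const_mul (l ! : ℝ)
  refine (h5.congr' ?_).trans_eq ?_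
  · filter_upwards [eventually_gt_atTop 0] with n hn
    have ht : (numUniformPartitions (l + 1) n : ℝ) ≠ 0 := by
      exact_mod_cast (numUniformPartitions_pos n).ne'
    have hc : ((((l + 1) * n + l).choose l : ℕ) : ℝ) ≠ 0 := by
      exact_mod_cast (Nat.choose_pos (by omega)).ne'
    have hN : (((l + 1) * n + l : ℕ) : ℝ) ≠ 0 := by
      exact_mod_cast (by positivity : 0 < (l + 1) * n + l).ne'
    have hs : numUniformPartitions (l + 1) (n + 1) =
        ((l + 1) * n + l).choose l * numUniformPartitions (l + 1) n := rfl
    have hl : (l ! : ℝ) ≠ 0 := by exact_mod_cast (Nat.factorial_pos l).ne'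
    rw [hs]
    simp only [Function.comp_apply, div_pow]
    push_cast at hN hc ⊢
    field_simp
  · congr 1
    push_cast
    rw [inv_one, mul_one, one_div, inv_pow]
    rfl

lemma tendsto_numUniformPartitions_sub_div {k : ℕ} (hk : 0 < k) (j : ℕ) :
    Tendsto (fun n : ℕ => (numUniformPartitions k (n - j) : ℝ) / numUniformPartitions k n *
      ((n : ℝ) ^ (k - 1)) ^ j) atTop (𝓝 (((k - 1)! / (k : ℝ) ^ (k - 1)) ^ j)) := by
  have hpos : ∀ n, (numUniformPartitions k n : ℝ) ≠ 0 := fun n => by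
    exact_mod_cast (numUniformPartitions_pos n).ne'
  induction j with
  | zero =>
    simp only [Nat.sub_zero, pow_zero, mul_one]
    exact tendsto_const_nhds.congr fun n => (div_self (hpos n)).symm
  | succ j ih =>
    have h1 := (tendsto_numUniformPartitions_pred_div hk).comp (tendsto_sub_atTop_nat j)
    have h2 : Tendsto (fun n : ℕ => ((n : ℝ) / ((n - j : ℕ) : ℝ)) ^ (k - 1)) atTop (𝓝 1) := by
      have h3 : Tendsto (fun n : ℕ => (n : ℝ) / ((n - j : ℕ) : ℝ)) atTop (𝓝 1) := by
        rw [← tendsto_add_atTop_iff_nat j]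
        simp only [Nat.add_sub_cancel]
        have h4 := (tendsto_const_div_atTop_nhds_zero_nat (j : ℝ)).const_add 1
        rw [add_zero] at h4
        refine h4.congr' ?_
        filter_upwards [eventually_gt_atTop 0] with n hn
        push_cast
        field_simp
      simpa using h3.pow (k - 1)
    have h5 := (ih.mul h1).mul h2
    rw [mul_one, ← pow_succ] at h5
    refine h5.congr' ?_
    filter_upwards [eventually_gt_atTop j] with n hn
    have hn' : (((n - j : ℕ) : ℝ)) ^ (k - 1) ≠ 0 :=
      pow_ne_zero _ (by exact_mod_cast (by omega : n - j ≠ 0))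
    have ha := hpos n
    have hb := hpos (n - j)
    simp only [Function.comp_apply, Nat.sub_sub, div_pow]
    field_simp
    ring

/-! ### Factorial moments -/

namespace LinearChordDiagram

lemma poissonRate_eq {k n : ℕ} (hk : 0 < k) (hn : 0 < n) :
    (poissonRate k n : ℝ) = k * n * (((k - 1)! / (k : ℝ) ^ (k - 1)) / (n : ℝ) ^ (k - 1)) := by
  obtain ⟨l, rfl⟩ : ∃ l, k = l + 1 := ⟨k - 1, by omega⟩
  have hn' : (n : ℝ) ≠ 0 := by positivity
  have hk' : ((l : ℝ) + 1) ≠ 0 := by positivity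
  simp only [poissonRate, NNReal.coe_mul, NNReal.coe_zpow, NNReal.coe_natCast]
  rw [show (1 : ℤ) - ((l + 1 : ℕ) : ℤ) = -(l : ℤ) by push_cast; ring,
    show (2 : ℤ) - ((l + 1 : ℕ) : ℤ) = 1 - (l : ℤ) by push_cast; ring,
    zpow_neg, zpow_sub₀ hn', zpow_one, zpow_natCast, zpow_natCast, Nat.factorial_succ,
    Nat.add_sub_cancel]
  push_cast
  field_simp

lemma poissonRate_pos {k n : ℕ} (hk : 0 < k) (hn : 0 < n) : 0 < (poissonRate k n : ℝ) := by
  rw [poissonRate_eq hk hn]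
  positivity

/-- The Poisson rate converges: to `1` for `k = 2` and to `0` for `k ≥ 3`. -/
lemma exists_tendsto_poissonRate {k : ℕ} (hk : 2 ≤ k) :
    ∃ L : ℝ, Tendsto (fun n => (poissonRate k n : ℝ)) atTop (𝓝 L) := by
  obtain ⟨l, rfl⟩ : ∃ l, k = l + 2 := ⟨k - 2, by omega⟩
  have h := ((tendsto_inv_atTop_nhds_zero_nat (𝕜 := ℝ)).pow l).const_mul
    (((l + 2 : ℕ) : ℝ) * ((l + 1)! / ((l + 2 : ℕ) : ℝ) ^ (l + 1)))
  refine ⟨_, h.congr' ?_⟩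
  filter_upwards [eventually_gt_atTop 0] with n hn
  have hn' : (n : ℝ) ≠ 0 := by positivity
  rw [poissonRate_eq (by omega) hn, show l + 2 - 1 = l + 1 by omega, inv_pow, pow_succ (n : ℝ)]
  field_simp

lemma factorialMoment_eq {k : ℕ} (hk : 0 < k) (n j : ℕ) :
    factorialMoment k n j =
      (j ! : ℝ) * ((∑ D : LinearChordDiagram k n, D.numComponents.choose j : ℕ) : ℝ) /
        numUniformPartitions k n := by
  rw [factorialMoment, card_eq_numUniformPartitions hk]
  simp only [Nat.descFactorial_eq_factorial_mul_choose, Nat.cast_mul, Nat.cast_sum,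
    Finset.mul_sum]

lemma factorialMoment_le {k : ℕ} (hk : 0 < k) (n j : ℕ) :
    factorialMoment k n j ≤
      ((k : ℝ) * n) ^ j * numUniformPartitions k (n - j) / numUniformPartitions k n := by
  rw [factorialMoment_eq hk]
  refine div_le_div_of_nonneg_right ?_ (Nat.cast_nonneg _)
  have h : j ! * ∑ D : LinearChordDiagram k n, D.numComponents.choose j ≤
      (k * n) ^ j * numUniformPartitions k (n - j) := by
    calc _ ≤ j ! * ((k * n).choose j * numUniformPartitions k (n - j)) :=
          Nat.mul_le_mul_left _ (sum_choose_numComponents_le hk n j)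
      _ = (k * n).descFactorial j * numUniformPartitions k (n - j) := by
          rw [Nat.descFactorial_eq_factorial_mul_choose, mul_assoc]
      _ ≤ _ := Nat.mul_le_mul_right _ (Nat.descFactorial_le_pow _ _)
  exact_mod_cast h

lemma le_factorialMoment {k : ℕ} (hk : 0 < k) (n j : ℕ) :
    (((k * n + 1 - k - j * (2 * k + 1) : ℕ) : ℝ) ^ j * numUniformPartitions k (n - j) -
      ((k : ℝ) * n) ^ j * (j * numUniformPartitions k (n - (j + 1)))) / numUniformPartitions k n ≤
      factorialMoment k n j := by
  rw [factorialMoment_eq hk]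
  gcongr
  rw [sub_le_iff_le_add]
  set N := k * n + 1 - k with hN
  have hF : j ! * (separatedSets k N j).card ≤ (k * n) ^ j := by
    have h1 : (separatedSets k N j).card ≤ N.choose j := by
      rw [← Finset.card_range N, ← Finset.card_powersetCard, Finset.card_range]
      exact Finset.card_le_card fun J hJ =>
        Finset.mem_powersetCard.2 (mem_separatedSets.1 hJ).1
    calc _ ≤ j ! * N.choose j := Nat.mul_le_mul_left _ h1
      _ = N.descFactorial j := (Nat.descFactorial_eq_factorial_mul_choose _ _).symm
      _ ≤ N ^ j := Nat.descFactorial_le_pow _ _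
      _ ≤ _ := Nat.pow_le_pow_left (by omega) j
  have h : (N - j * (2 * k + 1)) ^ j * numUniformPartitions k (n - j) ≤
      j ! * ∑ D : LinearChordDiagram k n, D.numComponents.choose j +
        (k * n) ^ j * (j * numUniformPartitions k (n - (j + 1))) := by
    calc _ ≤ j ! * (separatedSets k N j).card * numUniformPartitions k (n - j) :=
          Nat.mul_le_mul_right _ (pow_le_factorial_mul_card_separatedSets k N j le_rfl)
      _ ≤ j ! * (∑ D : LinearChordDiagram k n, D.numComponents.choose j +
          (separatedSets k N j).card * (j * numUniformPartitions k (n - (j + 1)))) := by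
          rw [mul_assoc]
          exact Nat.mul_le_mul_left _ (card_mul_le_sum_choose_numComponents hk n j)
      _ = j ! * ∑ D : LinearChordDiagram k n, D.numComponents.choose j +
          j ! * (separatedSets k N j).card * (j * numUniformPartitions k (n - (j + 1))) := by
          ring
      _ ≤ _ := Nat.add_le_add_left (Nat.mul_le_mul_right _ hF) _
  exact_mod_cast h

lemma tendsto_natCast_mul_sub_div {k : ℕ} (hk : 0 < k) (c d : ℕ) :
    Tendsto (fun n : ℕ => ((k * n + 1 - c - d : ℕ) : ℝ) / (k * n)) atTop (𝓝 1) := by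
  have h1 : Tendsto (fun n : ℕ => 1 + ((1 - c - d : ℝ) / k) / (n : ℝ)) atTop (𝓝 (1 + 0)) :=
    (tendsto_const_div_atTop_nhds_zero_nat _).const_add 1
  rw [add_zero] at h1
  refine h1.congr' ?_
  filter_upwards [eventually_ge_atTop (c + d + 1)] with n hn
  have hle : n ≤ k * n := Nat.le_mul_of_pos_left n hk
  have hn' : (n : ℝ) ≠ 0 := by exact_mod_cast (by omega : n ≠ 0)
  rw [Nat.cast_sub (by omega), Nat.cast_sub (by omega)]
  push_cast
  field_simp
  ring

/-- Both bounds for the factorial moment are asymptotic to the power of the rate: the term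
subtracted in the lower bound carries an additional factor `n ^ (1 - k)`. -/
lemma tendsto_factorialMoment_div {k : ℕ} (hk : 2 ≤ k) (j : ℕ) :
    Tendsto (fun n => factorialMoment k n j / (poissonRate k n : ℝ) ^ j) atTop (𝓝 1) := by
  have hk0 : 0 < k := by omega
  set c : ℝ := (k - 1)! / (k : ℝ) ^ (k - 1) with hc
  have hc0 : 0 < c := by positivity
  have hA := tendsto_numUniformPartitions_sub_div hk0 j
  have hB := tendsto_numUniformPartitions_sub_div hk0 (j + 1)
  rw [← hc] at hA hB
  have hup := hA.div_const (c ^ j)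
  rw [div_self (by positivity)] at hup
  have hpow : Tendsto (fun n : ℕ => ((n : ℝ) ^ (k - 1))⁻¹) atTop (𝓝 0) := by
    have := (tendsto_inv_atTop_nhds_zero_nat (𝕜 := ℝ)).pow (k - 1)
    rw [zero_pow (by omega)] at this
    simpa only [inv_pow] using this
  have hlow := ((((tendsto_natCast_mul_sub_div hk0 k (j * (2 * k + 1))).pow j).mul hA).sub
    ((hB.mul hpow).const_mul (j : ℝ))).div_const (c ^ j)
  rw [one_pow, one_mul, mul_zero, mul_zero, sub_zero, div_self (by positivity)] at hlow
  have hpos : ∀ n, (numUniformPartitions k n : ℝ) ≠ 0 := fun n => by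
    exact_mod_cast (numUniformPartitions_pos n).ne'
  refine tendsto_of_tendsto_of_tendsto_of_le_of_le' hlow hup ?_ ?_
  · filter_upwards [eventually_gt_atTop 0] with n hn
    have hr := poissonRate_pos hk0 hn
    rw [le_div_iff₀ (by positivity)]
    refine le_of_eq_of_le ?_ (le_factorialMoment hk0 n j)
    rw [poissonRate_eq hk0 hn, ← hc]
    have ht := hpos n
    have hn' : (n : ℝ) ≠ 0 := by positivity
    have hnk : (n : ℝ) ^ (k - 1) ≠ 0 := by positivity
    simp only [div_pow, mul_pow]
    field_simp
    ring
  · filter_upwards [eventually_gt_atTop 0] with n hn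
    have hr := poissonRate_pos hk0 hn
    rw [div_le_iff₀ (by positivity)]
    refine (factorialMoment_le hk0 n j).trans_eq ?_
    rw [poissonRate_eq hk0 hn, ← hc]
    have ht := hpos n
    have hnk : (n : ℝ) ^ (k - 1) ≠ 0 := by positivity
    simp only [div_pow, mul_pow]
    field_simp

end LinearChordDiagram

/-! ### From factorial moments to probabilities -/

/-- The Bonferroni inequalities for the indicator of `x = q`, with the truncation error bounded by
the first omitted term. -/
lemma abs_indicator_sub_sum_descFactorial_le (x q r : ℕ) :
    |(if x = q then (1 : ℝ) else 0) - ∑ i ∈ Finset.range (r + 1),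
      (-1) ^ i * ((x.descFactorial (q + i) : ℝ) / (q ! * i !))| ≤
      (x.descFactorial (q + (r + 1)) : ℝ) / (q ! * (r + 1)!) := by
  have hterm : ∀ i : ℕ, (x.descFactorial (q + i) : ℝ) / (q ! * i !) =
      x.choose q * (x - q).choose i := by
    intro i
    have hq : (q ! : ℝ) ≠ 0 := by positivity
    have hi : (i ! : ℝ) ≠ 0 := by positivity
    have h : x.descFactorial (q + i) = q ! * x.choose q * (i ! * (x - q).choose i) := by
      rw [← Nat.descFactorial_eq_factorial_mul_choose, ← Nat.descFactorial_eq_factorial_mul_choose,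
        mul_comm, ← Nat.descFactorial_mul_descFactorial (Nat.le_add_right q i),
        Nat.add_sub_cancel_left]
    rw [h]
    push_cast
    field_simp
  simp only [hterm]
  rcases lt_trichotomy x q with h | rfl | h
  · simp [Nat.choose_eq_zero_of_lt h, h.ne]
  · rw [Finset.sum_range_succ']
    simp
  · obtain ⟨m, rfl⟩ : ∃ m, x = q + (m + 1) := ⟨x - q - 1, by omega⟩
    rw [if_neg (by omega), Nat.add_sub_cancel_left]
    have h1 : ∑ i ∈ Finset.range (r + 1), (-1 : ℝ) ^ i * ((m + 1).choose i : ℝ) =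
        (-1) ^ r * m.choose r := by
      exact_mod_cast Int.alternating_sum_range_choose_eq_choose (n := m) (m := r)
    rw [Finset.sum_congr rfl fun i _ => mul_left_comm _ _ _, ← Finset.mul_sum, h1, zero_sub,
      abs_neg, abs_mul, abs_mul, abs_pow, abs_neg, abs_one, one_pow, one_mul, Nat.abs_cast,
      Nat.abs_cast]
    gcongr
    rw [Nat.choose_succ_succ]
    omega

/-- Interchange of limits: approximations `A r` of `u` whose errors `B r` have limits tending to
zero as `r → ∞`. -/
lemma tendsto_of_abs_sub_le {u : ℕ → ℝ} {A B : ℕ → ℕ → ℝ} {a b : ℕ → ℝ} {l : ℝ}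
    (h : ∀ r, ∀ᶠ n in atTop, |u n - A r n| ≤ B r n)
    (hA : ∀ r, Tendsto (A r) atTop (𝓝 (a r))) (hB : ∀ r, Tendsto (B r) atTop (𝓝 (b r)))
    (ha : Tendsto a atTop (𝓝 l)) (hb : Tendsto b atTop (𝓝 0)) : Tendsto u atTop (𝓝 l) := by
  rw [Metric.tendsto_nhds]
  intro ε hε
  have h1 := Metric.tendsto_nhds.1 ha (ε / 4) (by positivity)
  have h2 := Metric.tendsto_nhds.1 hb (ε / 4) (by positivity)
  obtain ⟨r, hr1, hr2⟩ := (h1.and h2).exists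
  have h3 := Metric.tendsto_nhds.1 (hA r) (ε / 4) (by positivity)
  have h4 := Metric.tendsto_nhds.1 (hB r) (ε / 4) (by positivity)
  filter_upwards [h r, h3, h4] with n hn hn3 hn4
  rw [Real.dist_eq, abs_lt] at *
  rw [abs_le] at hn
  constructor <;> linarith [hn.1, hn.2, hr1.1, hr1.2, hr2.1, hr2.2, hn3.1, hn3.2, hn4.1, hn4.2]

namespace LinearChordDiagram

lemma abs_probComponents_sub_sum_le {k : ℕ} (hk : 0 < k) (n q r : ℕ) :
    |probComponents k n q - ∑ i ∈ Finset.range (r + 1),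
      (-1) ^ i * (factorialMoment k n (q + i) / (q ! * i !))| ≤
      factorialMoment k n (q + (r + 1)) / (q ! * (r + 1)!) := by
  classical
  have hT : 0 < (Nat.card (LinearChordDiagram k n) : ℝ) := by
    rw [card_eq_numUniformPartitions hk]
    exact_mod_cast numUniformPartitions_pos n
  set T : ℝ := (Nat.card (LinearChordDiagram k n) : ℝ) with hTdef
  have hP : probComponents k n q =
      (∑ D : LinearChordDiagram k n, if D.numComponents = q then (1 : ℝ) else 0) / T := by
    rw [probComponents, Finset.sum_boole, Nat.card_eq_fintype_card, Fintype.card_subtype]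
  have hM : ∀ j l : ℕ, factorialMoment k n j / (q ! * l !) =
      (∑ D : LinearChordDiagram k n, (D.numComponents.descFactorial j : ℝ) / (q ! * l !)) / T := by
    intro j l
    rw [factorialMoment, ← Finset.sum_div, div_right_comm]
  have hS : ∑ i ∈ Finset.range (r + 1), (-1) ^ i * (factorialMoment k n (q + i) / (q ! * i !)) =
      (∑ D : LinearChordDiagram k n, ∑ i ∈ Finset.range (r + 1),
        (-1) ^ i * ((D.numComponents.descFactorial (q + i) : ℝ) / (q ! * i !))) / T := by
    rw [Finset.sum_comm, Finset.sum_div]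
    exact Finset.sum_congr rfl fun i _ => by rw [hM, ← Finset.mul_sum, mul_div_assoc]
  rw [hP, hS, hM, ← sub_div, ← Finset.sum_sub_distrib, abs_div, abs_of_pos hT]
  refine div_le_div_of_nonneg_right ?_ hT.le
  exact (Finset.abs_sum_le_sum_abs _ _).trans (Finset.sum_le_sum fun D _ =>
    abs_indicator_sub_sum_descFactorial_le D.numComponents q r)

lemma tendsto_probComponents_div {k : ℕ} (hk : 2 ≤ k) (q : ℕ) {L : ℝ}
    (hL : Tendsto (fun n => (poissonRate k n : ℝ)) atTop (𝓝 L)) :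
    Tendsto (fun n => probComponents k n q / (poissonRate k n : ℝ) ^ q) atTop
      (𝓝 (Real.exp (-L) / q !)) := by
  have hk0 : 0 < k := by omega
  -- The surplus factor `rate ^ i` of the moment of order `q + i` survives in the limit as `L ^ i`.
  have hM : ∀ i : ℕ, Tendsto (fun n => factorialMoment k n (q + i) / (q ! * i !) /
      (poissonRate k n : ℝ) ^ q) atTop (𝓝 (L ^ i / i ! / q !)) := by
    intro i
    have h := (((tendsto_factorialMoment_div hk (q + i)).mul (hL.pow i)).div_const
      (i ! : ℝ)).div_const (q ! : ℝ)
    rw [one_mul] at h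
    refine h.congr' ?_
    filter_upwards [eventually_gt_atTop 0] with n hn
    have hr := (poissonRate_pos hk0 hn).ne'
    rw [pow_add]
    field_simp
  refine tendsto_of_abs_sub_le
    (A := fun r n => ∑ i ∈ Finset.range (r + 1), (-1) ^ i *
      (factorialMoment k n (q + i) / (q ! * i !) / (poissonRate k n : ℝ) ^ q))
    (B := fun r n => factorialMoment k n (q + (r + 1)) / (q ! * (r + 1)!) /
      (poissonRate k n : ℝ) ^ q)
    (a := fun r => ∑ i ∈ Finset.range (r + 1), (-1) ^ i * (L ^ i / i ! / q !))
    (b := fun r => L ^ (r + 1) / (r + 1)! / q !) ?_ ?_ ?_ ?_ ?_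
  · intro r
    filter_upwards [eventually_gt_atTop 0] with n hn
    have hr := poissonRate_pos hk0 hn
    simp only [← mul_div_assoc, ← Finset.sum_div]
    rw [← sub_div, abs_div, abs_of_pos (pow_pos hr q)]
    gcongr
    simpa only [mul_div_assoc] using abs_probComponents_sub_sum_le hk0 n q r
  · exact fun r => tendsto_finsetSum _ fun i _ => (hM i).const_mul _
  · exact fun r => hM (r + 1)
  · have hexp := NormedSpace.expSeries_div_hasSum_exp (-L)
    rw [← Real.exp_eq_exp_ℝ] at hexp
    have h := (hexp.tendsto_sum_nat.comp (tendsto_add_atTop_nat 1)).div_const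
      (q ! : ℝ)
    refine h.congr fun r => ?_
    simp only [Function.comp_apply, Finset.sum_div]
    refine Finset.sum_congr rfl fun i _ => ?_
    rw [neg_pow]
    ring
  · have h := ((FloorSemiring.tendsto_pow_div_factorial_atTop L).comp
      (tendsto_add_atTop_nat 1)).div_const (q ! : ℝ)
    rwa [zero_div] at h

end LinearChordDiagram

end Asymptotics

theorem theorem23 (k : ℕ) (hk : 2 ≤ k) :
    (∀ q : ℕ, Asymptotics.IsEquivalent Filter.atTop
      (fun n : ℕ => LinearChordDiagram.probComponents k n q)
      (fun n : ℕ =>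
        (ProbabilityTheory.poissonMeasure (LinearChordDiagram.poissonRate k n)).real {q})) ∧
    (∀ j : ℕ, Asymptotics.IsEquivalent Filter.atTop
      (fun n : ℕ => LinearChordDiagram.factorialMoment k n j)
      (fun n : ℕ => (LinearChordDiagram.poissonRate k n : ℝ) ^ j)) := by
  have hk0 : 0 < k := by omega
  refine ⟨fun q => ?_, fun j => ?_⟩
  · simp only [ProbabilityTheory.poissonMeasure_real_singleton]
    obtain ⟨L, hL⟩ := LinearChordDiagram.exists_tendsto_poissonRate hk
    have h := (LinearChordDiagram.tendsto_probComponents_div hk q hL).mul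
      (((Real.continuous_exp.tendsto L).comp hL).mul_const (q ! : ℝ))
    have hlim : Real.exp (-L) / q ! * (Real.exp L * q !) = 1 := by
      rw [div_mul_eq_mul_div, ← mul_assoc, ← Real.exp_add, neg_add_cancel, Real.exp_zero, one_mul,
        div_self (by positivity)]
    rw [hlim] at h
    refine Asymptotics.isEquivalent_of_tendsto_one (h.congr fun n => ?_)
    simp only [Pi.div_apply, Function.comp_apply, Real.exp_neg]
    have := Real.exp_pos (LinearChordDiagram.poissonRate k n)
    field_simp
  · exact Asymptotics.isEquivalent_of_tendsto_one
      (LinearChordDiagram.tendsto_factorialMoment_div hk j)
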